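/- Let $\mathbb{B}$ be a Boolean algebra and let $n,m$ be positive integers. An $n$-partition of $\mathbb{B}$ is a set $R\subseteq\mathbb{B}$ with exactly $n$ elements (one of which may be $0$) such that $\bigvee R=1$ and $a\wedge b=0$ for all distinct $a,b\in R$. A set $A\subseteq\mathbb{B}$ is $(n,m)$-reaped by $R$ if $R$ is an $n$-partition of $\mathbb{B}$ and $|\{b\in R: b\wedge a\neq 0\}|\geq m$ for every $a\in A$. For $n,m\geq 2$, let the reaping number $\mathfrak{r}_{n,m}(\mathbb{B})$ be the least cardinality of a subset of $\mathbb{B}\setminus\{0\}$ which is not $(n,m)$-reaped by any $n$-partition of $\mathbb{B}$. For every integer $k\geq 2$ there is a Boolean algebra $\mathbb{B}$ such that $$\mathfrak{r}_{2k+1,3}(\mathbb{B})>\mathfrak{r}_{k,2}(\mathbb{B}),$$ that is, $\mathfrak{r}_{2k+1,3}(\mathbb{B})\not\leq\mathfrak{r}_{k,2}(\mathbb{B})$. -/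

import Mathlib

/-- An `n`-partition of a Boolean algebra `B`: a set `R` of exactly `n` elements of `B`
which are pairwise disjoint and have join `1`. -/
structure IsNPartition {B : Type*} [BooleanAlgebra B] (n : ℕ) (R : Finset B) : Prop where
  card_eq : R.card = n
  sup_eq_top : R.sup id = ⊤
  disjoint : ∀ a ∈ R, ∀ b ∈ R, a ≠ b → a ⊓ b = ⊥

/-- The set `A` is `(n, m)`-reaped by `R`: `R` is an `n`-partition and every `a ∈ A` has nonzero
meet with at least `m` members of `R`. -/
def IsReapedBy {B : Type*} [BooleanAlgebra B] (n m : ℕ) (A : Set B) (R : Finset B) : Prop :=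
  IsNPartition n R ∧ ∀ a ∈ A, m ≤ {b : B | b ∈ R ∧ b ⊓ a ≠ ⊥}.ncard

/-- The reaping number `𝔯_{n,m}(B)`: the least cardinality of a subset of `B \ {0}` which
is not `(n, m)`-reaped by any `n`-partition of `B`. -/
noncomputable def reapingNumber.{u} (n m : ℕ) (B : Type u) [BooleanAlgebra B] : Cardinal.{u} :=
  sInf {κ : Cardinal.{u} | ∃ A : Set B,
    (∀ a ∈ A, a ≠ ⊥) ∧ (¬ ∃ R : Finset B, IsReapedBy n m A R) ∧ Cardinal.mk A = κ}

/-- For `n, m ≥ 2` the set `B \ {0}` is not `(n, m)`-reaped, so the minimum defining the reaping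
number is taken over a nonempty family and is attained. -/
theorem reapingNumber_attained {B : Type*} [BooleanAlgebra B] {n m : ℕ} (hn : 2 ≤ n)
    (hm : 2 ≤ m) : ∃ A : Set B, (∀ a ∈ A, a ≠ ⊥) ∧ (¬ ∃ R : Finset B, IsReapedBy n m A R) ∧
      Cardinal.mk A = reapingNumber n m B := by
  refine csInf_mem (s := {κ | ∃ A : Set B, (∀ a ∈ A, a ≠ ⊥) ∧
    (¬ ∃ R : Finset B, IsReapedBy n m A R) ∧ Cardinal.mk A = κ})
    ⟨_, {a : B | a ≠ ⊥}, fun a ha => ha, ?_, rfl⟩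
  rintro ⟨R, hR, h⟩
  obtain ⟨a, ha, ha0⟩ : ∃ a ∈ R, a ≠ ⊥ :=
    Finset.exists_mem_ne (by have := hR.card_eq; omega) ⊥
  have hsub : {b : B | b ∈ R ∧ b ⊓ a ≠ ⊥} ⊆ {a} := by
    rintro b ⟨hb, hba⟩
    by_contra hne
    exact hba (hR.disjoint b hb a ha hne)
  have h1 := Set.ncard_le_ncard hsub (Set.finite_singleton a)
  have h2 := h a ha0
  rw [Set.ncard_singleton] at h1
  omega

/-! Only n > k(m-1) matters; here n = 2k+1 and m = 3. The points are pairs (j, y) with j in a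
countable set J and y : ω₁ → n, where j prescribes at each β a set of m admissible values for y β,
depending on finitely many earlier values. The algebra consists of the finitely supported sets of
points, and ℵ₀ separates the two numbers. The countably many fibres over J are not (k,2)-reaped: for
j outside its finite support, a k-partition is a k-colouring of the values of y on a finite F. By
pigeonhole, suitable rules make it constant (`exists_rules_monochromatic`), and by density some such
j has these rules on F, so its fibre lies in one piece. Countably many nonzero sets have supports
below some β < ω₁. A point of any of them can be altered from β upwards without leaving the set, and
takes m values at β; so the partition by the value at β reaps the family. -/

/-! ### Countable dense sets in products of ω₁ countable sets -/

/-- There is a well-order of type `ω₁` whose elements are coded by binary sequences. -/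
theorem exists_wellOrder_countable_Iio : ∃ (ι : Type) (_ : LinearOrder ι) (_ : WellFoundedLT ι),
    (∀ β : ι, Countable (Set.Iio β)) ∧ (∀ S : Set ι, S.Countable → ∃ β, ∀ s ∈ S, s < β) ∧
      ∃ e : ι → ℕ → Bool, Function.Injective e := by
  have hIio (β : (Cardinal.aleph 1).ord.ToType) : (Set.Iio β).Countable := by
    rw [← Cardinal.le_aleph0_iff_set_countable, ← Cardinal.lt_aleph_one_iff]
    simpa using Cardinal.mk_Iio_lt β (by simp)
  refine ⟨(Cardinal.aleph 1).ord.ToType, inferInstance, inferInstance,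
    fun β => (hIio β).to_subtype, fun S hS => ?_, ?_⟩
  · by_contra! h
    have huniv : (Set.univ : Set (Cardinal.aleph 1).ord.ToType) ⊆ ⋃ s ∈ S, Set.Iic s := by
      intro β _
      obtain ⟨s, hs, hle⟩ := h β
      exact Set.mem_biUnion hs hle
    have hcount : (Set.univ : Set (Cardinal.aleph 1).ord.ToType).Countable := by
      refine (hS.biUnion fun s _ => ?_).mono huniv
      rw [← Set.Iio_insert]
      exact (hIio s).insert s
    rw [← Cardinal.le_aleph0_iff_set_countable, ← Cardinal.lt_aleph_one_iff,
      Cardinal.mk_univ, Cardinal.mk_ord_toType] at hcount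
    exact lt_irrefl _ hcount
  · have hle : Cardinal.mk (Cardinal.aleph 1).ord.ToType ≤ Cardinal.mk (ℕ → Bool) := by
      rw [Cardinal.mk_ord_toType]
      simpa using Cardinal.aleph_one_le_continuum
    obtain ⟨e⟩ := Cardinal.le_def _ _ |>.1 hle
    exact ⟨e, e.injective⟩

/-- Finitely many binary sequences are separated by their restrictions to some `Fin m`. -/
theorem exists_restrict_injOn {ι : Type*} {e : ι → ℕ → Bool} (he : Function.Injective e)
    (F : Finset ι) : ∃ m : ℕ, Set.InjOn (fun β (i : Fin m) => e β i) F := by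
  classical
  have hsep (p : ι × ι) : ∃ i, p.1 ≠ p.2 → e p.1 i ≠ e p.2 i := by
    by_cases hp : p.1 = p.2
    · exact ⟨0, fun h => absurd hp h⟩
    · obtain ⟨i, hi⟩ := Function.ne_iff.1 (he.ne hp)
      exact ⟨i, fun _ => hi⟩
  choose d hd using hsep
  refine ⟨(F ×ˢ F).sup d + 1, fun β hβ γ hγ h => ?_⟩
  by_contra hne
  have hle : d (β, γ) ≤ (F ×ˢ F).sup d :=
    Finset.le_sup (f := d) (Finset.mk_mem_product hβ hγ)
  exact hd (β, γ) hne (congrFun h ⟨d (β, γ), Nat.lt_succ_of_le hle⟩)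

/-- An independent family indexed by at most continuum many indices: a countable set of choice
functions that is dense in the product of countable sets. -/
theorem exists_countable_dense_family {ι : Type*} {e : ι → ℕ → Bool} (he : Function.Injective e)
    (Q : ι → Type*) [∀ β, Countable (Q β)] [∀ β, Nonempty (Q β)] :
    ∃ (J : Type) (_ : Countable J) (f : J → ∀ β, Q β),
      ∀ (F : Finset ι) (N : Finset J) (t : ∀ β, Q β), ∃ j ∉ N, ∀ β ∈ F, f j β = t β := by
  classical
  choose s hs using fun β => exists_surjective_nat (Q β)
  -- The middle ℕ is a dummy: it repeats each choice function infinitely often, so that the finite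
  -- set `N` can be avoided.
  refine ⟨Σ m : ℕ, ℕ × ((Fin m → Bool) → ℕ), inferInstance,
    fun j β => s β (j.2.2 fun i => e β i), fun F N t => ?_⟩
  obtain ⟨m, hm⟩ := exists_restrict_injOn he F
  choose u hu using fun β => hs β (t β)
  obtain ⟨g, hg⟩ : ∃ g : (Fin m → Bool) → ℕ, ∀ β ∈ F, g (fun i => e β i) = u β := by
    refine ⟨fun v => if h : ∃ β ∈ F, (fun i : Fin m => e β i) = v then u h.choose else 0,
      fun β hβ => ?_⟩
    have h : ∃ γ ∈ F, (fun i : Fin m => e γ i) = fun i : Fin m => e β i := ⟨β, hβ, rfl⟩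
    refine (dif_pos h).trans ?_
    exact congrArg u (hm h.choose_spec.1 hβ h.choose_spec.2)
  have hinj : Function.Injective
      (fun d : ℕ => (⟨m, d, g⟩ : Σ m : ℕ, ℕ × ((Fin m → Bool) → ℕ))) := by
    intro d d' h
    simpa using h
  obtain ⟨j, ⟨d, rfl⟩, hj⟩ := (Set.infinite_range_of_injective hinj).exists_notMem_finset N
  exact ⟨_, hj, fun β hβ => by simp only [hg β hβ, hu]⟩

/-! ### Branching rules and the functions obeying them -/

/-- A rule assigning to each function on the predecessors of `β` a set of `m` admissible values at
`β`, depending on finitely many coordinates only. -/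
abbrev BranchingRule {ι : Type*} [LinearOrder ι] (K : Type*) (m : ℕ) (β : ι) :=
  Σ G : Finset (Set.Iio β), ((G → K) → {S : Finset K // S.card = m})

namespace BranchingRule

variable {ι K : Type*} [LinearOrder ι] {m : ℕ}

/-- The set of values admitted at `β` by a rule, given the values below `β`. -/
def eval {β : ι} (q : BranchingRule K m β) (y : ι → K) : Finset K :=
  (q.2 fun g => y g.1.1).1

theorem card_eval {β : ι} (q : BranchingRule K m β) (y : ι → K) : (q.eval y).card = m :=
  (q.2 fun g => y g.1.1).2

theorem eval_congr {β : ι} (q : BranchingRule K m β) {y y' : ι → K} (h : ∀ γ < β, y γ = y' γ) :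
    q.eval y = q.eval y' := by
  have : (fun g : q.1 => y g.1.1) = fun g : q.1 => y' g.1.1 := funext fun g => h _ g.1.2
  rw [eval, eval, this]

/-- The rule admitting the same values everywhere. -/
def const (β : ι) (S : {S : Finset K // S.card = m}) : BranchingRule K m β := ⟨∅, fun _ => S⟩

theorem eval_const (β : ι) (S : {S : Finset K // S.card = m}) (y : ι → K) :
    (const β S).eval y = S.1 := rfl

/-- The functions obeying all the rules. -/
def branches (q : ∀ β : ι, BranchingRule K m β) : Set (ι → K) := {y | ∀ β, y β ∈ (q β).eval y}

/-- Rules look only downwards, so a choice at `β` never conflicts with later rules: above `β`,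
admissible values are picked by well-founded recursion. -/
theorem exists_mem_branches_extending [WellFoundedLT ι] (hm : 0 < m)
    (q : ∀ β : ι, BranchingRule K m β) {β : ι} {y : ι → K} (hy : ∀ γ < β, y γ ∈ (q γ).eval y)
    {i : K} (hi : i ∈ (q β).eval y) :
    ∃ y' ∈ branches q, (∀ γ < β, y' γ = y γ) ∧ y' β = i := by
  classical
  have hne (γ : ι) (z : ι → K) : ∃ k, k ∈ (q γ).eval z :=
    Finset.card_pos.1 ((card_eval (q γ) z).symm ▸ hm)
  choose g hg using hne
  let step (γ : ι) (rec : ∀ δ, δ < γ → K) : K :=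
    if γ < β then y γ else if γ = β then i else
      -- The default `i` is harmless, since a rule at `γ` reads only values below `γ`.
      g γ fun δ => if h : δ < γ then rec δ h else i
  let y' : ι → K := (wellFounded_lt (α := ι)).fix step
  have hfix (γ : ι) : y' γ = step γ fun δ _ => y' δ := WellFounded.fix_eq _ _ _
  have hlt (γ : ι) (h : γ < β) : y' γ = y γ := by rw [hfix]; exact if_pos h
  have heq : y' β = i := by rw [hfix]; simp [step]
  refine ⟨y', fun γ => ?_, hlt, heq⟩
  rcases lt_trichotomy γ β with h | rfl | h
  · rw [hlt γ h, eval_congr (q γ) fun δ hδ => hlt δ (hδ.trans h)]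
    exact hy γ h
  · rw [heq, eval_congr (q γ) hlt]
    exact hi
  · have hstep : y' γ = g γ fun δ => if δ < γ then y' δ else i := by
      rw [hfix]
      simp [step, h.not_gt, h.ne']
    have hev : (q γ).eval y' = (q γ).eval fun δ => if δ < γ then y' δ else i :=
      eval_congr _ fun δ hδ => (if_pos hδ).symm
    rw [hev, hstep]
    exact hg _ _

theorem branches_nonempty [WellFoundedLT ι] [Nonempty K] (hm : 0 < m)
    (q : ∀ β : ι, BranchingRule K m β) : (branches q).Nonempty := by
  classical
  by_contra hempty
  have hbad (y : ι → K) : ∃ β, y β ∉ (q β).eval y := by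
    by_contra! h
    exact hempty ⟨y, h⟩
  have y₀ : ι → K := fun _ => Classical.arbitrary K
  -- This yields an index, hence a least one, where the extension lemma has no condition to check;
  -- without indices `y₀` itself would obey all rules.
  obtain ⟨β, -⟩ := hbad y₀
  obtain ⟨b, -, hmin⟩ := (wellFounded_lt (α := ι)).has_min Set.univ ⟨β, trivial⟩
  obtain ⟨i, hi⟩ : ((q b).eval y₀).Nonempty :=
    Finset.card_pos.1 ((card_eval (q b) y₀).symm ▸ hm)
  obtain ⟨y, hy, -⟩ :=
    exists_mem_branches_extending hm q (β := b) (fun γ hγ => absurd hγ (hmin γ trivial)) hi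
  exact hempty ⟨y, hy⟩

/-- A colouring of functions by few colours that depends on finitely many coordinates is constant
on the functions obeying suitable rules. -/
theorem exists_rules_monochromatic {C : Type*} [Fintype C] [Fintype K] [Nonempty K]
    (hmK : m ≤ Fintype.card K) (hCK : Fintype.card C * (m - 1) < Fintype.card K)
    (F : Finset ι) (c : (ι → K) → C)
    (hc : ∀ y y' : ι → K, (∀ β ∈ F, y β = y' β) → c y = c y') :
    ∃ (q : ∀ β, BranchingRule K m β) (r : C),
      ∀ y, (∀ β ∈ F, y β ∈ (q β).eval y) → c y = r := by
  classical
  have hpigeon (g : K → C) : ∃ (T : {S : Finset K // S.card = m}) (r : C), ∀ i ∈ T.1, g i = r := by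
    obtain ⟨r, -, hr⟩ := Finset.exists_lt_card_fiber_of_mul_lt_card_of_maps_to
      (s := Finset.univ) (t := Finset.univ) (f := g) (n := m - 1) (by simp)
      (by simpa using hCK)
    obtain ⟨T, hT, hcard⟩ := Finset.exists_subset_card_eq (Nat.le_of_pred_lt hr)
    exact ⟨⟨T, hcard⟩, r, fun i hi => (Finset.mem_filter.1 (hT hi)).2⟩
  choose T r hTr using hpigeon
  induction F using Finset.induction_on_max generalizing c with
  | empty =>
    obtain ⟨S, -, hS⟩ := Finset.exists_subset_card_eq (s := (Finset.univ : Finset K)) hmK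
    exact ⟨fun β => const β ⟨S, hS⟩, c fun _ => Classical.arbitrary K,
      fun y _ => hc _ _ (by simp)⟩
  | insert a s hs ih =>
    -- The largest coordinate is removed: the new colour of `y` is one shared by at least `m` values
    -- at `a`, which the rule at `a` will then impose.
    obtain ⟨q, r₀, hq⟩ := ih (fun y => r fun i => c (Function.update y a i)) (by
      intro y y' h
      congr 1
      funext i
      refine hc _ _ fun β hβ => ?_
      rcases Finset.mem_insert.1 hβ with rfl | hβ
      · simp
      · simp [(hs β hβ).ne, h β hβ])
    let G : Finset (Set.Iio a) := s.subtype (· ∈ Set.Iio a)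
    let ext (v : G → K) (δ : ι) : K :=
      if h : δ ∈ s then v ⟨⟨δ, hs δ h⟩, Finset.mem_subtype.2 h⟩ else Classical.arbitrary K
    let qa : BranchingRule K m a := ⟨G, fun v => T fun i => c (Function.update (ext v) a i)⟩
    have hqa (y : ι → K) : qa.eval y = (T fun i => c (Function.update y a i)).1 := by
      have : (fun i => c (Function.update (ext fun g => y g.1.1) a i)) =
          fun i => c (Function.update y a i) := by
        funext i
        refine hc _ _ fun β hβ => ?_
        rcases Finset.mem_insert.1 hβ with rfl | hβ
        · simp
        · simp [(hs β hβ).ne, ext, hβ]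
      exact congrArg (fun g => (T g).1) this
    refine ⟨Function.update q a qa, r₀, fun y hy => ?_⟩
    have hya := hy a (Finset.mem_insert_self a s)
    rw [Function.update_self, hqa] at hya
    rw [← hq y fun β hβ => ?_]
    · simpa using hTr _ _ hya
    · simpa [(hs β hβ).ne] using hy β (Finset.mem_insert_of_mem hβ)

end BranchingRule

/-! ### The algebra of finitely supported sets -/

/-- Two points of `J × (ι → K)` agree on a finite set of coordinates, and also on their first
components up to identifying all elements outside a finite set. -/
def AgreeOn {J ι K : Type*} (N : Finset J) (F : Finset ι) (z z' : J × (ι → K)) : Prop :=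
  (z.1 = z'.1 ∨ z.1 ∉ N ∧ z'.1 ∉ N) ∧ ∀ β ∈ F, z.2 β = z'.2 β

theorem AgreeOn.mono {J ι K : Type*} {N N' : Finset J} {F F' : Finset ι} {z z' : J × (ι → K)}
    (h : AgreeOn N' F' z z') (hN : N ⊆ N') (hF : F ⊆ F') : AgreeOn N F z z' :=
  ⟨h.1.imp_right fun h' => ⟨fun h₁ => h'.1 (hN h₁), fun h₁ => h'.2 (hN h₁)⟩,
    fun β hβ => h.2 β (hF hβ)⟩

/-- A set of points is supported by `N` and `F` if membership depends only on the data recorded by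
`AgreeOn N F`. -/
def SupportedBy {J ι K : Type*} {Z : Set (J × (ι → K))} (N : Finset J) (F : Finset ι)
    (U : Set Z) : Prop :=
  ∀ z z' : Z, AgreeOn N F z.1 z'.1 → (z ∈ U ↔ z' ∈ U)

theorem SupportedBy.mono {J ι K : Type*} {Z : Set (J × (ι → K))} {N N' : Finset J}
    {F F' : Finset ι} {U : Set Z} (h : SupportedBy N F U) (hN : N ⊆ N') (hF : F ⊆ F') :
    SupportedBy N' F' U :=
  fun z z' hz => h z z' (hz.mono hN hF)

open Classical in
/-- The Boolean algebra of the sets of points with finite support. -/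
def finitelySupported {J ι K : Type*} (Z : Set (J × (ι → K))) : BooleanSubalgebra (Set Z) where
  carrier := {U | ∃ N F, SupportedBy N F U}
  supClosed' := by
    rintro U ⟨N, F, h⟩ V ⟨N', F', h'⟩
    exact ⟨N ∪ N', F ∪ F', fun z z' hz => or_congr
      (h z z' (hz.mono Finset.subset_union_left Finset.subset_union_left))
      (h' z z' (hz.mono Finset.subset_union_right Finset.subset_union_right))⟩
  infClosed' := by
    rintro U ⟨N, F, h⟩ V ⟨N', F', h'⟩
    exact ⟨N ∪ N', F ∪ F', fun z z' hz => and_congr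
      (h z z' (hz.mono Finset.subset_union_left Finset.subset_union_left))
      (h' z z' (hz.mono Finset.subset_union_right Finset.subset_union_right))⟩
  compl_mem' := by
    rintro U ⟨N, F, h⟩
    exact ⟨N, F, fun z z' hz => not_congr (h z z' hz)⟩
  bot_mem' := ⟨∅, ∅, fun _ _ _ => Iff.rfl⟩

section FinitelySupported

variable {J ι K : Type*} {Z : Set (J × (ι → K))}

theorem finitelySupported_ne_bot {U : finitelySupported Z} : U ≠ ⊥ ↔ ∃ z, z ∈ U.1 := by
  rw [← Set.Nonempty, Set.nonempty_iff_ne_empty]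
  exact not_congr (Subtype.ext_iff (a1 := U) (a2 := ⊥))

theorem exists_common_support (R : Finset (finitelySupported Z)) :
    ∃ N F, ∀ U ∈ R, SupportedBy N F U.1 := by
  classical
  choose N F h using fun U : finitelySupported Z => U.2
  exact ⟨R.biUnion N, R.biUnion F, fun U hU =>
    (h U).mono (Finset.subset_biUnion_of_mem N hU) (Finset.subset_biUnion_of_mem F hU)⟩

theorem finitelySupported_sup_eq_top_iff {R : Finset (finitelySupported Z)} :
    R.sup id = ⊤ ↔ ∀ z, ∃ U ∈ R, z ∈ U.1 := by
  have h : (R.sup id).1 = R.sup fun U => U.1 :=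
    Finset.apply_sup_eq_sup_comp (fun U : finitelySupported Z => U.1) (fun _ _ => rfl) rfl
  rw [Subtype.ext_iff, h, BooleanSubalgebra.val_top, Set.top_eq_univ, Set.eq_univ_iff_forall]
  simp [Finset.sup_eq_iSup]

/-- The set of points with a given first component. -/
def fibreOver (Z : Set (J × (ι → K))) (j : J) : finitelySupported Z :=
  ⟨{z | z.1.1 = j}, {j}, ∅, fun z z' hz => by
    rcases hz.1 with h | ⟨h, h'⟩
    · simp [h]
    · simp_all⟩

/-- The set of points with value `i` at `β`. -/
def coordinateEq (Z : Set (J × (ι → K))) (β : ι) (i : K) : finitelySupported Z :=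
  ⟨{z | z.1.2 β = i}, ∅, {β}, fun z z' hz => by simp [hz.2 β (by simp)]⟩

end FinitelySupported

/-! ### Reaping in the algebra given by a dense family of rules -/

open BranchingRule

section Construction

variable {J ι K : Type*} [LinearOrder ι] {m : ℕ}

/-- The points obeying the rules attached to their first component. -/
def rulePoints (f : J → ∀ β : ι, BranchingRule K m β) : Set (J × (ι → K)) :=
  {z | z.2 ∈ branches (f z.1)}

/-- The fibres are not `(k, 2)`-reaped when the rules are dense and `k` is small. -/
theorem not_isReapedBy_range_fibreOver [Fintype K] [Nonempty K]
    (f : J → ∀ β : ι, BranchingRule K m β)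
    (hf : ∀ (F : Finset ι) (N : Finset J) (t : ∀ β, BranchingRule K m β),
      ∃ j ∉ N, ∀ β ∈ F, f j β = t β)
    {k : ℕ} (hk : 0 < k) (hmK : m ≤ Fintype.card K)
    (hkK : k * (m - 1) < Fintype.card K) :
    ¬ ∃ R, IsReapedBy k 2 (Set.range (fibreOver (rulePoints f))) R := by
  classical
  rintro ⟨R, hR, hreap⟩
  obtain ⟨N, F, hsupp⟩ := exists_common_support R
  have hcover := finitelySupported_sup_eq_top_iff.1 hR.sup_eq_top
  obtain ⟨U₀, hU₀⟩ : R.Nonempty := Finset.card_pos.1 (hR.card_eq.symm ▸ hk)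
  have hcol (v : F → K) : ∃ U : R, ∀ z : rulePoints f,
      z.1.1 ∉ N → (∀ β : F, z.1.2 β = v β) → z ∈ U.1.1 := by
    -- A pattern realised outside `N` has all its points in one piece, by support; an unrealised one
    -- gets the arbitrary colour `U₀`.
    by_cases h : ∃ z : rulePoints f, z.1.1 ∉ N ∧ ∀ β : F, z.1.2 β = v β
    · obtain ⟨z, hzN, hz⟩ := h
      obtain ⟨U, hU, hzU⟩ := hcover z
      refine ⟨⟨U, hU⟩, fun z' hN' hz' => (hsupp U hU z z' ⟨Or.inr ⟨hzN, hN'⟩, ?_⟩).1 hzU⟩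
      intro β hβ
      rw [hz ⟨β, hβ⟩, hz' ⟨β, hβ⟩]
    · exact ⟨⟨U₀, hU₀⟩, fun z hN hz => absurd ⟨z, hN, hz⟩ h⟩
  choose c hc using hcol
  obtain ⟨q, r, hq⟩ := exists_rules_monochromatic (C := R) hmK
    (by simpa [hR.card_eq] using hkK) F (fun y => c fun β => y β)
    (fun y y' h => congrArg c (funext fun β => h β β.2))
  obtain ⟨j, hjN, hj⟩ := hf F N q
  have hmono (z : rulePoints f) (hz : z.1.1 = j) : z ∈ r.1.1 := by
    rw [← hq z.1.2 fun β hβ => ?_]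
    · exact hc _ z (hz ▸ hjN) fun _ => rfl
    · rw [← hj β hβ, ← hz]
      exact z.2 β
  have hsub : {b | b ∈ R ∧ b ⊓ fibreOver (rulePoints f) j ≠ ⊥} ⊆ {r.1} := by
    rintro b ⟨hb, hne⟩
    by_contra hbr
    obtain ⟨z, hzb, hzj⟩ := finitelySupported_ne_bot.1 hne
    have hbr₀ : b ⊓ r.1 ≠ ⊥ := finitelySupported_ne_bot.2 ⟨z, hzb, hmono z hzj⟩
    exact hbr₀ (hR.disjoint b hb r.1 r.2 hbr)
  have h₁ := Set.ncard_le_ncard hsub (Set.finite_singleton _)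
  have h₂ := hreap _ ⟨j, rfl⟩
  rw [Set.ncard_singleton] at h₁
  omega

variable [WellFoundedLT ι]

theorem fibreOver_rulePoints_ne_bot [Nonempty K] (hm : 0 < m)
    (f : J → ∀ β : ι, BranchingRule K m β) (j : J) : fibreOver (rulePoints f) j ≠ ⊥ := by
  obtain ⟨y, hy⟩ := branches_nonempty hm (f j)
  exact finitelySupported_ne_bot.2 ⟨⟨(j, y), hy⟩, rfl⟩

theorem coordinateEq_rulePoints_ne_bot [Fintype K] [Nonempty K] (hm : 0 < m)
    (hmK : m ≤ Fintype.card K) (f : J → ∀ β : ι, BranchingRule K m β)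
    (hf : ∀ (F : Finset ι) (N : Finset J) (t : ∀ β, BranchingRule K m β),
      ∃ j ∉ N, ∀ β ∈ F, f j β = t β) (β : ι) (i : K) :
    coordinateEq (rulePoints f) β i ≠ ⊥ := by
  classical
  obtain ⟨S, hiS, -, hS⟩ := Finset.exists_subsuperset_card_eq (s := {i}) (Finset.subset_univ _)
    (by simpa using Nat.succ_le_of_lt hm) (by simpa using hmK)
  -- Density provides a `j` whose rule at `β` always admits `i`.
  obtain ⟨j, -, hj⟩ := hf {β} ∅ fun γ => const γ ⟨S, hS⟩
  obtain ⟨y, hy⟩ := branches_nonempty hm (f j)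
  have hi : i ∈ (f j β).eval y := by
    rw [hj β (by simp), eval_const]
    exact hiS (by simp)
  obtain ⟨y', hy', -, rfl⟩ := exists_mem_branches_extending hm (f j) (fun γ _ => hy γ) hi
  exact finitelySupported_ne_bot.2 ⟨⟨(j, y'), hy'⟩, rfl⟩

/-- Every countable family of nonzero sets is reaped by the values at a coordinate above all the
supports. -/
theorem exists_isReapedBy_of_countable [Fintype K] [Nonempty K] (hm : 0 < m)
    (hmK : m ≤ Fintype.card K) (f : J → ∀ β : ι, BranchingRule K m β)
    (hf : ∀ (F : Finset ι) (N : Finset J) (t : ∀ β, BranchingRule K m β),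
      ∃ j ∉ N, ∀ β ∈ F, f j β = t β)
    (hbdd : ∀ S : Set ι, S.Countable → ∃ β, ∀ s ∈ S, s < β)
    {A : Set (finitelySupported (rulePoints f))} (hA : A.Countable) (hA₀ : ∀ a ∈ A, a ≠ ⊥) :
    ∃ R, IsReapedBy (Fintype.card K) m A R := by
  classical
  choose N F hsupp using fun U : finitelySupported (rulePoints f) => U.2
  obtain ⟨β, hβ⟩ := hbdd (⋃ U ∈ A, (F U : Set ι)) (hA.biUnion fun U _ => (F U).countable_toSet)
  have hdisj (i i' : K) (h : i ≠ i') :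
      coordinateEq (rulePoints f) β i ⊓ coordinateEq (rulePoints f) β i' = ⊥ := by
    by_contra hne
    obtain ⟨z, hz, hz'⟩ := finitelySupported_ne_bot.1 hne
    exact h (Eq.trans (Eq.symm hz) hz')
  have hinj : Function.Injective (coordinateEq (rulePoints f) β) := by
    intro i i' h
    by_contra hne
    have h₁ := hdisj i i' hne
    rw [← h, inf_idem] at h₁
    exact coordinateEq_rulePoints_ne_bot hm hmK f hf β i h₁
  refine ⟨Finset.univ.image (coordinateEq (rulePoints f) β), ⟨?_, ?_, ?_⟩, fun a ha => ?_⟩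
  · rw [Finset.card_image_of_injective _ hinj, Finset.card_univ]
  · exact finitelySupported_sup_eq_top_iff.2 fun z =>
      ⟨_, Finset.mem_image_of_mem _ (Finset.mem_univ (z.1.2 β)), rfl⟩
  · simp only [Finset.mem_image, Finset.mem_univ, true_and]
    rintro _ ⟨i, rfl⟩ _ ⟨i', rfl⟩ h
    exact hdisj i i' fun h' => h (congrArg _ h')
  · obtain ⟨z, hz⟩ := finitelySupported_ne_bot.1 (hA₀ a ha)
    set S := (f z.1.1 β).eval z.1.2 with hS
    have hsub : (S.image (coordinateEq (rulePoints f) β) : Set (finitelySupported (rulePoints f)))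
        ⊆ {b | b ∈ Finset.univ.image (coordinateEq (rulePoints f) β) ∧ b ⊓ a ≠ ⊥} := by
      intro b hb
      obtain ⟨i, hi, rfl⟩ := Finset.mem_image.1 (Finset.mem_coe.1 hb)
      refine ⟨Finset.mem_image_of_mem _ (Finset.mem_univ i), finitelySupported_ne_bot.2 ?_⟩
      -- The new point keeps the first component of `z` and its values below `β`, where the support
      -- of `a` lies, so it stays in `a`.
      obtain ⟨y, hy, hlt, hyi⟩ :=
        exists_mem_branches_extending hm (f z.1.1) (β := β) (fun γ _ => z.2 γ) hi
      refine ⟨⟨(z.1.1, y), hy⟩, hyi,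
        (hsupp a z ⟨(z.1.1, y), hy⟩ ⟨Or.inl rfl, fun γ hγ => ?_⟩).1 hz⟩
      exact (hlt γ (hβ γ (Set.mem_biUnion ha hγ))).symm
    have hcard : (S.image (coordinateEq (rulePoints f) β)).card = m := by
      rw [Finset.card_image_of_injective _ hinj, hS, card_eval]
    refine hcard.symm.le.trans ?_
    rw [← Set.ncard_coe_finset]
    exact Set.ncard_le_ncard hsub
      ((Finset.finite_toSet (Finset.univ.image (coordinateEq (rulePoints f) β))).subset
        fun _ h => h.1)

end Construction

/-- If `n > k (m - 1)`, then some Boolean algebra satisfies `𝔯_{k,2} < 𝔯_{n,m}`. -/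
theorem exists_reapingNumber_lt {k n m : ℕ} (hk : 2 ≤ k) (hm : 2 ≤ m) (hn : k * (m - 1) < n) :
    ∃ (B : Type) (_ : BooleanAlgebra B), reapingNumber k 2 B < reapingNumber n m B := by
  obtain ⟨ι, _, _, hcount, hbdd, e, he⟩ := exists_wellOrder_countable_Iio
  have hmn : m ≤ n := by
    -- As `m ≥ 2`, m ≤ 2(m-1) ≤ k(m-1) < n.
    have := Nat.mul_le_mul_right (m - 1) hk
    omega
  have : Nonempty (Fin n) := ⟨⟨0, by omega⟩⟩
  obtain ⟨S, -, hS⟩ := Finset.exists_subset_card_eq (s := (Finset.univ : Finset (Fin n)))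
    (n := m) (by simpa using hmn)
  have (β : ι) : Nonempty (BranchingRule (Fin n) m β) := ⟨const β ⟨S, hS⟩⟩
  obtain ⟨J, _, f, hf⟩ := exists_countable_dense_family he fun β => BranchingRule (Fin n) m β
  refine ⟨finitelySupported (rulePoints f), inferInstance,
    lt_of_le_of_lt (b := Cardinal.aleph0) ?_ ?_⟩
  · refine le_trans (csInf_le' ⟨Set.range (fibreOver (rulePoints f)), ?_,
      not_isReapedBy_range_fibreOver f hf (by omega) (by simpa using hmn)
        (by simpa using hn), rfl⟩)
      (Cardinal.le_aleph0_iff_set_countable.2 (Set.countable_range _))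
    rintro _ ⟨j, rfl⟩
    exact fibreOver_rulePoints_ne_bot (by omega) f j
  · obtain ⟨A, hA₀, hA, hcard⟩ :=
      reapingNumber_attained (B := finitelySupported (rulePoints f)) (hm.trans hmn) hm
    rw [← hcard]
    by_contra! hle
    have hreap := exists_isReapedBy_of_countable (by omega) (by simpa using hmn) f hf hbdd
      (Cardinal.le_aleph0_iff_set_countable.1 hle) hA₀
    rw [Fintype.card_fin] at hreap
    exact hA hreap

theorem mainTheorem12 (k : ℕ) (hk : 2 ≤ k) :
    ∃ (B : Type) (_ : BooleanAlgebra B), reapingNumber k 2 B < reapingNumber (2 * k + 1) 3 B := by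
  exact exists_reapingNumber_lt hk (by norm_num) (by omega)
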